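/- Let $(X,\mathfrak M,\mu)$ be a measure space. A family $\mathfrak B\subset\mathfrak M$ (whose members are called balls) is a ball-basis with hull constant $K$ if: (B1) $0<\mu(B)<\infty$ for every $B\in\mathfrak B$; (B2) any two points $x,y\in X$ lie in a common ball; (B3) for every $E\in\mathfrak M$ and $\varepsilon>0$ there is a finite (possibly empty) or infinite sequence of balls $B_k$ with $\mu\left(E\,\triangle\,\bigcup_k B_k\right)<\varepsilon$; (B4) for every $B\in\mathfrak B$ there is $B^*\in\mathfrak B$ that contains every $A\in\mathfrak B$ with $\mu(A)\le 2\mu(B)$ and $A\cap B\ne\varnothing$, and satisfies $\mu(B^*)\le K\mu(B)$. No doubling condition is imposed. For $0<\gamma<1$, a collection $\mathcal S\subset\mathfrak B$ is $\gamma$-sparse if there are pairwise disjoint measurable sets $E_B\subset B$, $B\in\mathcal S$, with $\mu(E_B)\ge\gamma\mu(B)$. For $1\le r<\infty$ put $$\langle f\rangle_{B,r}=\Big(\frac1{\mu(B)}\int_B|f|^r\,d\mu\Big)^{1/r},\qquad \langle f\rangle^*_{B,r}=\sup_{A\in\mathfrak B,\ A\supset B}\langle f\rangle_{A,r},\qquad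 \mathcal A^*_{\mathcal S,r}f(x)=\sum_{A\in\mathcal S}\langle f\rangle^*_{A,r}\,\mathbf 1_A(x).$$ Theorem. Let $1\le r<\infty$, $K>0$ and $0<\gamma<1$. For every $p$ with $r<p<\infty$ there is a constant $C$ depending only on $p,r,K,\gamma$, and there is a constant $C'$ depending only on $r,K,\gamma$, such that for every measure space with a ball-basis $\mathfrak B$ with hull constant $K$ and every $\gamma$-sparse collection $\mathcal S\subset\mathfrak B$, the operator $\mathcal A^*_{\mathcal S,r}$ maps $L^p(X)$ to $L^p(X)$ with $$\|\mathcal A^*_{\mathcal S,r}f\|_p\le C\,\|f\|_p\qquad (f\in L^p(X)),$$ and satisfies the weak-$L^r$ estimate $$\mu\{x\in X:\ \mathcal A^*_{\mathcal S,r}f(x)>\lambda\}\le C'\,\frac{\|f\|_r^r}{\lambda^r}\qquad (f\in L^r(X),\ \lambda>0).$$ -/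

import Mathlib

open MeasureTheory
open scoped ENNReal NNReal

/-- `ℬ` is a ball-basis of the measure space `(X, μ)` with hull constant `K`. -/
structure IsBallBasis {X : Type*} [MeasurableSpace X] (μ : Measure X) (ℬ : Set (Set X))
    (K : ℝ≥0) : Prop where
  /-- Balls are measurable. -/
  measurableSet : ∀ B ∈ ℬ, MeasurableSet B
  /-- Balls have positive measure. -/
  measure_pos : ∀ B ∈ ℬ, 0 < μ B
  /-- Balls have finite measure. -/
  measure_lt_top : ∀ B ∈ ℬ, μ B < ∞
  /-- Any two points lie in a common ball. -/
  exists_mem_mem : ∀ x y : X, ∃ B ∈ ℬ, x ∈ B ∧ y ∈ B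
  /-- Measurable sets are approximated in measure by countable unions of balls. -/
  exists_approx : ∀ E : Set X, MeasurableSet E → ∀ ε : ℝ≥0∞, 0 < ε →
    ∃ 𝒞 : Set (Set X), 𝒞.Countable ∧ 𝒞 ⊆ ℬ ∧ μ (symmDiff E (⋃₀ 𝒞)) < ε
  /-- Every ball `B` has a hull `H`. -/
  exists_hull : ∀ B ∈ ℬ, ∃ H ∈ ℬ,
    (⋃ A ∈ {A ∈ ℬ | μ A ≤ 2 * μ B ∧ (A ∩ B).Nonempty}, A) ⊆ H ∧ μ H ≤ K * μ B

/-- The collection `S` is `γ`-sparse: every `B ∈ S` has a measurable part `E B` with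
`μ (E B) ≥ γ μ B`, and these parts are pairwise disjoint. -/
def IsSparse {X : Type*} [MeasurableSpace X] (μ : Measure X) (γ : ℝ≥0)
    (S : Set (Set X)) : Prop :=
  ∃ E : Set X → Set X,
    (∀ B ∈ S, MeasurableSet (E B) ∧ E B ⊆ B ∧ γ * μ B ≤ μ (E B)) ∧ S.PairwiseDisjoint E

/-- The average `⟨f⟩_{B,r} = (μ(B)⁻¹ ∫_B |f|^r)^{1/r}`, as an extended nonnegative number. -/
noncomputable def ballAverage {X 𝕜 : Type*} [MeasurableSpace X] [RCLike 𝕜] (μ : Measure X)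
    (r : ℝ) (f : X → 𝕜) (B : Set X) : ℝ≥0∞ :=
  ((∫⁻ x in B, ‖f x‖ₑ ^ r ∂μ) / μ B) ^ (1 / r)

/-- `⟨f⟩*_{B,r}`, the supremum of `⟨f⟩_{A,r}` over the balls `A ∈ ℬ` that contain `B`. -/
noncomputable def ballAverageSup {X 𝕜 : Type*} [MeasurableSpace X] [RCLike 𝕜] (μ : Measure X)
    (ℬ : Set (Set X)) (r : ℝ) (f : X → 𝕜) (B : Set X) : ℝ≥0∞ :=
  ⨆ A ∈ {A ∈ ℬ | B ⊆ A}, ballAverage μ r f A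

/-- The sparse operator of strong type, `∑_{A ∈ S} ⟨f⟩*_{A,r} 𝟙_A`. -/
noncomputable def strongSparse {X 𝕜 : Type*} [MeasurableSpace X] [RCLike 𝕜] (μ : Measure X)
    (ℬ S : Set (Set X)) (r : ℝ) (f : X → 𝕜) (x : X) : ℝ≥0∞ :=
  ∑' A : S, (A : Set X).indicator (fun _ => ballAverageSup μ ℬ r f A) x

/-! ### Countability and the weak type `(1,1)` maximal inequality. -/

namespace IsBallBasis

variable {X : Type*} [MeasurableSpace X] {μ : Measure X} {ℬ S : Set (Set X)} {K : ℝ≥0}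

/-! Write `c A` for `⟨f⟩*_{A,r}`. If `a < c A ^ r`, some ball `B ⊇ A` has `a * μ B < ∫_B |f|^r`, so
`A` lies where the uncentred maximal function of `|f|^r` exceeds `a`. A Vitali selection, with hulls
in place of doubling, gives that function weak type `(1,1)`. Its level sets appear as unions of
balls, so its measurability never matters.

Strong type: as the `E A` are disjoint, the distribution of `c ^ r` under the weights `μ (E A)` is
dominated by that of the maximal function. Interpolation then bounds `∑ μ (E A) * c A ^ p` by
`‖f‖_p^p` (`tsum_measure_mul_rpow_le`). Conversely, `u = ∑ c A 𝟙_A` is controlled by that sum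
through duality: test `u` against `u ^ (p - 1)` and apply the same embedding to `u ^ (p - 1)`
(`lintegral_finset_sum_rpow_le`).

Weak type: balls with `c A > λ` lie in a maximal level set of admissible measure. For the others `c
A ≤ λ`, so the `L^{2r}` bound and Chebyshev suffice; no Calderón–Zygmund decomposition is needed. -/

theorem sigmaFinite (h : IsBallBasis μ ℬ K) : SigmaFinite μ := by
  -- Countably many balls cover `X` up to a remainder of measure below `1`, which serves as one more
  -- piece.
  obtain ⟨𝒞, hc, hs, hlt⟩ := h.exists_approx Set.univ MeasurableSet.univ 1 one_pos
  refine Measure.sigmaFinite_of_countable (S := insert (symmDiff Set.univ (⋃₀ 𝒞)) 𝒞) (hc.insert _) ?_ ?_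
  · rintro s (rfl | hs')
    · exact hlt.trans ENNReal.one_lt_top
    · exact h.measure_lt_top s (hs hs')
  · ext x
    by_cases hx : x ∈ ⋃₀ 𝒞 <;> simp_all [Set.mem_symmDiff]

/-- The weak type `(1,1)` inequality for the maximal function of a ball-basis. -/
theorem mul_measure_sUnion_le (h : IsBallBasis μ ℬ K) (φ : X → ℝ≥0∞) (a : ℝ≥0∞) :
    a * μ (⋃₀ {B ∈ ℬ | a * μ B < ∫⁻ x in B, φ x ∂μ}) ≤ K * ∫⁻ x, φ x ∂μ := by
  have := h.sigmaFinite
  set t := {B ∈ ℬ | a * μ B < ∫⁻ x in B, φ x ∂μ} with ht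
  rcases eq_or_ne a 0 with rfl | ha
  · simp
  rcases t.eq_empty_or_nonempty with he | ⟨B₀, hB₀⟩
  · simp [he]
  choose! H hHℬ hHsub hHle using h.exists_hull
  have hK : (K : ℝ≥0∞) ≠ 0 := by
    intro hK
    have h1 := hHle B₀ hB₀.1
    have h2 := h.measure_pos _ (hHℬ B₀ hB₀.1)
    rw [hK, zero_mul] at h1
    exact absurd h1 (not_le.2 h2)
  rcases eq_or_ne (∫⁻ x, φ x ∂μ) ∞ with hφ | hφ
  · rw [hφ, ENNReal.mul_top hK]; exact le_top
  have hμt : ∀ B ∈ t, μ B ≤ (∫⁻ x, φ x ∂μ) / a := fun B hB => by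
    rw [ENNReal.le_div_iff_mul_le (Or.inl ha) (Or.inr hφ), mul_comm]
    exact hB.2.le.trans (setLIntegral_le_lintegral _ _)
  -- Size is measured by `μ`. The ratio `2` is the one in the hull axiom, so the hull of a selected
  -- ball contains every ball charged to it.
  obtain ⟨u, hut, hdisj, hu⟩ := Vitali.exists_disjoint_subfamily_covering_enlargement
    (fun B : Set X => B) t (fun B => (μ B).toReal) 2 one_lt_two
    (fun _ _ => ENNReal.toReal_nonneg) ((∫⁻ x, φ x ∂μ) / a).toReal
    (fun B hB => ENNReal.toReal_mono (ENNReal.div_ne_top hφ ha) (hμt B hB))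
    (fun B hB => nonempty_of_measure_ne_zero (h.measure_pos B hB.1).ne')
  have huc : u.Countable := by
    have := Measure.countable_meas_pos_of_disjoint_iUnion (μ := μ) (As := fun B : u => (B : Set X))
      (fun B => h.measurableSet _ (hut B.2).1)
      (fun A B hAB => hdisj A.2 B.2 (fun hh => hAB (Subtype.ext hh)))
    have hall : {B : u | 0 < μ (B : Set X)} = Set.univ :=
      Set.eq_univ_of_forall fun B => h.measure_pos _ (hut B.2).1
    rw [hall, Set.countable_univ_iff] at this
    exact Set.countable_coe_iff.1 this
  have hcover : ⋃₀ t ⊆ ⋃ B ∈ u, H B := by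
    rintro x ⟨A, hA, hx⟩
    obtain ⟨B, hB, hAB, hle⟩ := hu A hA
    refine Set.mem_biUnion hB (hHsub B (hut hB).1 (Set.mem_biUnion ⟨hA.1, ?_, hAB⟩ hx))
    have hBt := (h.measure_lt_top B (hut hB).1).ne
    rw [← ENNReal.toReal_le_toReal (h.measure_lt_top A hA.1).ne
      (ENNReal.mul_ne_top ENNReal.ofNat_ne_top hBt), ENNReal.toReal_mul]
    simpa using hle
  calc a * μ (⋃₀ t) ≤ a * ∑' B : u, μ (H B) := by
        gcongr
        exact (measure_mono hcover).trans (measure_biUnion_le μ huc _)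
    _ ≤ a * ∑' B : u, K * μ B := by
        gcongr with B
        exact hHle B (hut B.2).1
    _ = K * ∑' B : u, a * μ B := by
        rw [ENNReal.tsum_mul_left, ENNReal.tsum_mul_left]; ring
    _ ≤ K * ∑' B : u, ∫⁻ x in B, φ x ∂μ := by
        gcongr with B
        exact (hut B.2).2.le
    _ = K * ∫⁻ x in ⋃ B ∈ u, B, φ x ∂μ := by
        rw [lintegral_biUnion huc (fun B hB => h.measurableSet B (hut hB).1) hdisj]
    _ ≤ K * ∫⁻ x, φ x ∂μ := by
        gcongr
        exact Measure.restrict_le_self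

theorem countable_of_pairwiseDisjoint (h : IsBallBasis μ ℬ K) (hS : S ⊆ ℬ) {γ : ℝ≥0} (hγ : 0 < γ)
    {E : Set X → Set X} (hE : ∀ B ∈ S, MeasurableSet (E B) ∧ E B ⊆ B ∧ γ * μ B ≤ μ (E B))
    (hd : S.PairwiseDisjoint E) : S.Countable := by
  have := h.sigmaFinite
  have hc := Measure.countable_meas_pos_of_disjoint_iUnion (μ := μ) (As := fun B : S => E B)
    (fun B => (hE B B.2).1) (fun A B hAB => hd A.2 B.2 (fun hh => hAB (Subtype.ext hh)))
  have hall : {B : S | 0 < μ (E B)} = Set.univ :=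
    Set.eq_univ_of_forall fun B => lt_of_lt_of_le
      (ENNReal.mul_pos (by simpa using hγ.ne') (h.measure_pos _ (hS B.2)).ne') (hE B B.2).2.2
  rw [hall, Set.countable_univ_iff] at hc
  exact Set.countable_coe_iff.1 hc

end IsBallBasis

/-! ### Layer-cake formula and interpolation. -/

theorem lintegral_rpow_eq_lintegral_measure_ofReal_lt {Z : Type*} [MeasurableSpace Z]
    {ρ : Measure Z} {g : Z → ℝ≥0∞} (hg : AEMeasurable g ρ) (hgtop : ∀ᵐ z ∂ρ, g z ≠ ∞)
    {q : ℝ} (hq : 0 < q) :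
    ∫⁻ z, g z ^ q ∂ρ = ENNReal.ofReal q *
      ∫⁻ t in Set.Ioi (0 : ℝ), ρ {z | ENNReal.ofReal t < g z} * ENNReal.ofReal (t ^ (q - 1)) := by
  have h1 : ∫⁻ z, g z ^ q ∂ρ = ∫⁻ z, ENNReal.ofReal ((g z).toReal ^ q) ∂ρ := by
    refine lintegral_congr_ae ?_
    filter_upwards [hgtop] with z hz
    rw [← ENNReal.ofReal_rpow_of_nonneg ENNReal.toReal_nonneg hq.le, ENNReal.ofReal_toReal hz]
  rw [h1, lintegral_rpow_eq_lintegral_meas_lt_mul ρ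
    (Filter.Eventually.of_forall fun _ => ENNReal.toReal_nonneg) hg.ennreal_toReal hq]
  congr 1
  refine setLIntegral_congr_fun measurableSet_Ioi fun t ht => ?_
  have : ρ {z | t < (g z).toReal} = ρ {z | ENNReal.ofReal t < g z} := by
    refine measure_congr ?_
    filter_upwards [hgtop] with z hz
    exact propext (ENNReal.ofReal_lt_iff_lt_toReal (le_of_lt ht) hz).symm
  simp only [this]

/-- Marcinkiewicz interpolation in integrated form: truncated weak-type bounds give a strong-type
bound for exponents above one. -/
theorem lintegral_rpow_le_of_mul_measure_lt_le {X Y : Type*} [MeasurableSpace X]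
    [MeasurableSpace Y] {μ : Measure X} {ν : Measure Y} {F : Y → ℝ≥0∞} {φ : X → ℝ≥0∞}
    (hF : AEMeasurable F ν) (hφ : AEMeasurable φ μ) {s : ℝ} (hs : 1 < s) {K : ℝ≥0}
    (hfin : ∫⁻ x, φ x ^ s ∂μ ≠ ∞)
    (h : ∀ t : ℝ, 0 < t → ENNReal.ofReal t * ν {y | ENNReal.ofReal t < F y} ≤
      K * μ.withDensity φ {x | ENNReal.ofReal t < 2 * φ x}) :
    ∫⁻ y, F y ^ s ∂ν ≤
      ENNReal.ofReal (s / (s - 1)) * (K * (2 ^ (s - 1) * ∫⁻ x, φ x ^ s ∂μ)) := by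
  have hs0 : 0 < s := by linarith
  have hs1 : 0 < s - 1 := by linarith
  have hφρ : AEMeasurable φ (μ.withDensity φ) := hφ.mono_ac (withDensity_absolutelyContinuous _ _)
  have hφtop : ∀ᵐ x ∂μ.withDensity φ, 2 * φ x ≠ ∞ := by
    refine (withDensity_absolutelyContinuous μ φ).ae_le ?_
    filter_upwards [ae_lt_top' (hφ.pow_const s) hfin] with x hx hxt
    have : φ x = ∞ := by
      by_contra hne
      exact ENNReal.mul_ne_top ENNReal.ofNat_ne_top hne hxt
    simp [this, ENNReal.top_rpow_of_pos hs0] at hx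
  have hpow : ∫⁻ x, (2 * φ x) ^ (s - 1) ∂μ.withDensity φ = 2 ^ (s - 1) * ∫⁻ x, φ x ^ s ∂μ := by
    rw [lintegral_withDensity_eq_lintegral_mul₀ hφ ((hφ.const_mul 2).pow_const _),
      ← lintegral_const_mul'' _ (hφ.pow_const s)]
    refine lintegral_congr fun x => ?_
    rw [Pi.mul_apply, ENNReal.mul_rpow_of_nonneg _ _ hs1.le, mul_left_comm]
    congr 1
    conv_lhs => enter [1]; rw [← ENNReal.rpow_one (φ x)]
    rw [← ENNReal.rpow_add_of_nonneg _ _ zero_le_one hs1.le]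
    simp
  -- The layer-cake formula needs this. At levels `n + 1 ≥ 1` Markov bounds the right side of `h`
  -- independently of `n`, while the left side is at least `n * ν {F = ∞}`.
  have hFtop : ∀ᵐ y ∂ν, F y ≠ ∞ := by
    rw [ae_iff]
    by_contra hne
    obtain ⟨n, hn⟩ := ENNReal.exists_nat_mul_gt (b := K * (2 ^ (s - 1) * ∫⁻ x, φ x ^ s ∂μ)) hne
      (ENNReal.mul_ne_top ENNReal.coe_ne_top (ENNReal.mul_ne_top (by simp) hfin))
    have hsub : {y | ¬ F y ≠ ∞} ⊆ {y | ENNReal.ofReal ((n : ℝ) + 1) < F y} := fun y hy => by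
      have : F y = ∞ := not_not.1 hy
      simp [this]
    refine absurd hn (not_lt.2 ?_)
    calc (n : ℝ≥0∞) * ν {y | ¬ F y ≠ ∞}
        ≤ ENNReal.ofReal ((n : ℝ) + 1) * ν {y | ENNReal.ofReal ((n : ℝ) + 1) < F y} := by
          gcongr
          rw [← ENNReal.ofReal_natCast]
          exact ENNReal.ofReal_le_ofReal (by linarith)
      _ ≤ _ := h ((n : ℝ) + 1) (by positivity)
      _ ≤ K * (1 * μ.withDensity φ {x | 1 ≤ (2 * φ x) ^ (s - 1)}) := by
          rw [one_mul]
          gcongr with x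
          intro hx
          refine ENNReal.one_le_rpow (le_trans ?_ hx.le) hs1
          rw [← ENNReal.ofReal_one]
          exact ENNReal.ofReal_le_ofReal (by linarith [n.cast_nonneg (α := ℝ)])
      _ ≤ _ := by
          rw [← hpow]
          gcongr
          exact mul_meas_ge_le_lintegral₀ ((hφρ.const_mul 2).pow_const _) 1
  rw [lintegral_rpow_eq_lintegral_measure_ofReal_lt hF hFtop hs0, ← hpow,
    lintegral_rpow_eq_lintegral_measure_ofReal_lt (hφρ.const_mul 2) hφtop hs1]
  -- Since `t ^ (s - 1) = t * t ^ (s - 2)`, the hypothesis turns the layer-cake integral of `F ^ s`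
  -- into that of `(2 * φ) ^ (s - 1)` under `φ dμ`. The prefactors `s` and `s - 1` leave `s / (s -
  -- 1)`.
  calc ENNReal.ofReal s * ∫⁻ t in Set.Ioi (0 : ℝ),
        ν {y | ENNReal.ofReal t < F y} * ENNReal.ofReal (t ^ (s - 1))
      ≤ ENNReal.ofReal s * ∫⁻ t in Set.Ioi (0 : ℝ),
        K * (μ.withDensity φ {x | ENNReal.ofReal t < 2 * φ x} *
          ENNReal.ofReal (t ^ (s - 1 - 1))) := by
        refine mul_le_mul_right ?_ _
        refine setLIntegral_mono' measurableSet_Ioi fun t ht => ?_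
        have ht : 0 < t := ht
        have : ENNReal.ofReal (t ^ (s - 1)) =
            ENNReal.ofReal t * ENNReal.ofReal (t ^ (s - 1 - 1)) := by
          rw [← ENNReal.ofReal_mul ht.le, Real.rpow_sub_one ht.ne' (s - 1)]
          congr 1
          field_simp
        rw [this, ← mul_assoc, ← mul_assoc, mul_comm (ν _)]
        exact mul_le_mul_left (h t ht) _
    _ = _ := by
        rw [lintegral_const_mul' _ _ ENNReal.coe_ne_top, ENNReal.ofReal_div_of_pos hs1,
          div_eq_mul_inv]
        have hne : ENNReal.ofReal (s - 1) ≠ 0 := by simpa using hs1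
        have hcancel : (ENNReal.ofReal (s - 1))⁻¹ * ENNReal.ofReal (s - 1) = 1 :=
          ENNReal.inv_mul_cancel hne ENNReal.ofReal_ne_top
        generalize (∫⁻ t in Set.Ioi (0 : ℝ), μ.withDensity φ {x | ENNReal.ofReal t < 2 * φ x} *
          ENNReal.ofReal (t ^ (s - 1 - 1))) = I
        calc ENNReal.ofReal s * (K * I) = ENNReal.ofReal s *
              ((ENNReal.ofReal (s - 1))⁻¹ * ENNReal.ofReal (s - 1)) * (K * I) := by
              rw [hcancel, mul_one]
          _ = _ := by ring

/-- The measure on an index type with point masses `w i`, for which all sets are measurable. -/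
noncomputable def pointMasses {ι : Type*} (w : ι → ℝ≥0∞) : @Measure ι ⊤ :=
  letI : MeasurableSpace ι := ⊤
  Measure.sum fun i => w i • Measure.dirac i

theorem lintegral_pointMasses {ι : Type*} (w g : ι → ℝ≥0∞) :
    @lintegral ι ⊤ (pointMasses w) g = ∑' i, w i * g i := by
  let : MeasurableSpace ι := ⊤
  rw [pointMasses, lintegral_sum_measure]
  refine tsum_congr fun i => ?_
  rw [lintegral_smul_measure, lintegral_dirac' i (fun _ _ => trivial), smul_eq_mul]

theorem pointMasses_apply {ι : Type*} (w : ι → ℝ≥0∞) (s : Set ι) :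
    (pointMasses w) s = ∑' i, s.indicator w i := by
  let : MeasurableSpace ι := ⊤
  rw [pointMasses, Measure.sum_apply _ (MeasurableSpace.measurableSet_top)]
  refine tsum_congr fun i => ?_
  by_cases hi : i ∈ s <;> simp [hi]

/-- The constant in the Carleson embedding theorem for a ball-basis. -/
noncomputable def carlesonConst (s : ℝ) (K : ℝ≥0) : ℝ≥0 :=
  Real.toNNReal (s / (s - 1)) * (2 * K * 2 ^ (s - 1))

/-- The constant in the estimate of sparse sums by disjoint sums. -/
noncomputable def sparseConst (p : ℝ) (K γ : ℝ≥0) : ℝ≥0 :=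
  (γ ^ p)⁻¹ * carlesonConst (p / (p - 1)) K ^ (p - 1)

/-! ### Carleson embedding and `L^p` bounds for sparse sums. -/

namespace IsBallBasis

variable {X : Type*} [MeasurableSpace X] {μ : Measure X} {ℬ S : Set (Set X)} {K γ : ℝ≥0}
  {E : Set X → Set X} {φ : X → ℝ≥0∞}

/-- The weak type inequality for the maximal function with the truncated function on the right. -/
theorem mul_measure_sUnion_le_withDensity (h : IsBallBasis μ ℬ K) (hφ : AEMeasurable φ μ)
    (a : ℝ≥0∞) :
    a * μ (⋃₀ {B ∈ ℬ | a * μ B < ∫⁻ x in B, φ x ∂μ}) ≤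
      (2 * K : ℝ≥0) * μ.withDensity φ {x | a < 2 * φ x} := by
  have := h.sigmaFinite
  set T := {x | a < 2 * φ x} with hT
  have hTm : NullMeasurableSet T μ := nullMeasurableSet_lt aemeasurable_const (hφ.const_mul 2)
  -- Values of `φ` up to `a / 2` contribute at most `a / 2 * μ B`, so the larger values must account
  -- for more than the other half.
  have hsub : {B ∈ ℬ | a * μ B < ∫⁻ x in B, φ x ∂μ} ⊆
      {B ∈ ℬ | a / 2 * μ B < ∫⁻ x in B, T.indicator φ x ∂μ} := by
    rintro B ⟨hB, hlt⟩
    refine ⟨hB, lt_of_not_ge fun hge => absurd hlt (not_lt.2 ?_)⟩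
    calc ∫⁻ x in B, φ x ∂μ ≤ ∫⁻ x in B, (T.indicator φ x + a / 2) ∂μ := by
          refine lintegral_mono fun x => ?_
          by_cases hx : x ∈ T
          · simp [hx]
          · rw [Set.indicator_of_notMem hx, zero_add,
              ENNReal.le_div_iff_mul_le (by simp) (by simp), mul_comm]
            exact not_lt.1 hx
      _ = ∫⁻ x in B, T.indicator φ x ∂μ + a / 2 * μ B := by
          rw [lintegral_add_right _ measurable_const, setLIntegral_const]
      _ ≤ a / 2 * μ B + a / 2 * μ B := by gcongr
      _ = a * μ B := by rw [← add_mul, ENNReal.add_halves]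
  calc a * μ (⋃₀ {B ∈ ℬ | a * μ B < ∫⁻ x in B, φ x ∂μ})
      ≤ 2 * (a / 2) * μ (⋃₀ {B ∈ ℬ | a / 2 * μ B < ∫⁻ x in B, T.indicator φ x ∂μ}) := by
        rw [ENNReal.mul_div_cancel (by simp) (by simp)]
        gcongr
    _ ≤ 2 * (K * ∫⁻ x, T.indicator φ x ∂μ) := by
        rw [mul_assoc]
        exact mul_le_mul_right (h.mul_measure_sUnion_le _ _) _
    _ = _ := by
        rw [lintegral_indicator₀ hTm, withDensity_apply', ENNReal.coe_mul, mul_assoc]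
        rfl

/-- The sum is the measure of a disjoint union of sets `E A`, each inside a ball with large average.
This compares the discrete distribution of `c` with the maximal function. -/
theorem tsum_indicator_measure_le (hS : S.Countable)
    (hE : ∀ A ∈ S, MeasurableSet (E A) ∧ E A ⊆ A ∧ γ * μ A ≤ μ (E A)) (hd : S.PairwiseDisjoint E)
    (c : Set X → ℝ≥0∞)
    (hc : ∀ A ∈ S, ∀ a < c A, ∃ B ∈ ℬ, A ⊆ B ∧ a * μ B < ∫⁻ x in B, φ x ∂μ) (a : ℝ≥0∞) :
    ∑' A : S, {A : S | a < c A}.indicator (fun A : S => μ (E A)) A ≤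
      μ (⋃₀ {B ∈ ℬ | a * μ B < ∫⁻ x in B, φ x ∂μ}) := by
  have := hS.to_subtype
  calc ∑' A : S, {A : S | a < c A}.indicator (fun A : S => μ (E A)) A
      = ∑' A : S, μ {x | x ∈ E A ∧ a < c A} := by
        refine tsum_congr fun A => ?_
        by_cases hA : a < c A <;> simp [hA]
    _ = μ (⋃ A : S, {x | x ∈ E A ∧ a < c A}) := by
        refine (measure_iUnion ?_ ?_).symm
        · intro A B hAB
          exact (hd A.2 B.2 fun hh => hAB (Subtype.ext hh)).mono (fun x hx => hx.1) fun x hx => hx.1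
        · exact fun A => (hE A A.2).1.inter (MeasurableSet.const _)
    _ ≤ _ := by
        refine measure_mono (Set.iUnion_subset fun A x hx => ?_)
        obtain ⟨B, hB, hAB, hlt⟩ := hc A A.2 a hx.2
        exact ⟨B, ⟨hB, hlt⟩, hAB ((hE A A.2).2.1 hx.1)⟩

/-- The Carleson embedding theorem for sparse families in a ball-basis. -/
theorem tsum_measure_mul_rpow_le (h : IsBallBasis μ ℬ K) (hS : S.Countable)
    (hE : ∀ A ∈ S, MeasurableSet (E A) ∧ E A ⊆ A ∧ γ * μ A ≤ μ (E A)) (hd : S.PairwiseDisjoint E)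
    (c : Set X → ℝ≥0∞)
    (hc : ∀ A ∈ S, ∀ a < c A, ∃ B ∈ ℬ, A ⊆ B ∧ a * μ B < ∫⁻ x in B, φ x ∂μ)
    (hφ : AEMeasurable φ μ) {s : ℝ} (hs : 1 < s) (hfin : ∫⁻ x, φ x ^ s ∂μ ≠ ∞) :
    ∑' A : S, μ (E A) * c A ^ s ≤ carlesonConst s K * ∫⁻ x, φ x ^ s ∂μ := by
  have key := @lintegral_rpow_le_of_mul_measure_lt_le X S _ ⊤ μ
    (pointMasses fun A : S => μ (E A)) (fun A : S => c A) φ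
    (@Measurable.aemeasurable _ _ ⊤ _ _ _ (fun _ _ => trivial)) hφ s hs (2 * K) hfin
    (fun t ht => by
      rw [pointMasses_apply]
      exact (mul_le_mul_right (tsum_indicator_measure_le hS hE hd c hc _) _).trans
        (h.mul_measure_sUnion_le_withDensity hφ _))
  rw [lintegral_pointMasses] at key
  refine key.trans (le_of_eq ?_)
  rw [carlesonConst, ENNReal.coe_mul (Real.toNNReal _), ENNReal.coe_mul (2 * K) (2 ^ (s - 1)),
    ENNReal.coe_rpow_of_nonneg _ (by linarith : 0 ≤ s - 1), ENNReal.ofReal]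
  push_cast
  ring

/-- Sums over a sparse family are controlled in `L^p`, `p > 1`, by the sums over its disjoint
parts: the case of finitely many summands. -/
theorem lintegral_finset_sum_rpow_le (h : IsBallBasis μ ℬ K) (hSℬ : S ⊆ ℬ) (hγ : 0 < γ)
    (hE : ∀ A ∈ S, MeasurableSet (E A) ∧ E A ⊆ A ∧ γ * μ A ≤ μ (E A)) (hd : S.PairwiseDisjoint E)
    (c : Set X → ℝ≥0∞) (hc : ∀ A ∈ S, c A ≠ ∞) {p : ℝ} (hp : 1 < p) (T : Finset S) :
    ∫⁻ x, (∑ A ∈ T, (A : Set X).indicator (fun _ => c A) x) ^ p ∂μ ≤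
      sparseConst p K γ * ∑' A : S, μ (E A) * c A ^ p := by
  have hp0 : 0 < p := by linarith
  have hp1 : 0 < p - 1 := by linarith
  have hS := h.countable_of_pairwiseDisjoint hSℬ hγ hE hd
  set D := ∑' A : S, μ (E A) * c A ^ p with hD
  set u : X → ℝ≥0∞ := fun x => ∑ A ∈ T, (A : Set X).indicator (fun _ => c A) x with hu
  have hmeas : ∀ A : S, MeasurableSet (A : Set X) := fun A => h.measurableSet A (hSℬ A.2)
  have hum : Measurable u := Finset.measurable_sum _ fun A _ => measurable_const.indicator (hmeas A)
  set I := ∫⁻ x, u x ^ p ∂μ with hI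
  -- This is why finite sums come first: finiteness permits the embedding for `u ^ (p - 1)` and the
  -- final division by `I ^ (p - 1)`.
  have hItop : I ≠ ∞ := by
    set N := ∑ A ∈ T, c A with hN
    have hNtop : N ^ p ≠ ∞ :=
      ENNReal.rpow_ne_top_of_nonneg hp0.le (ENNReal.sum_ne_top.2 fun A _ => hc A A.2)
    have hle : ∀ x, u x ^ p ≤ ∑ A ∈ T, (A : Set X).indicator (fun _ => N ^ p) x := fun x => by
      by_cases hx : ∃ A ∈ T, x ∈ (A : Set X)
      · obtain ⟨A, hAT, hxA⟩ := hx
        calc u x ^ p ≤ N ^ p :=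
              ENNReal.rpow_le_rpow (Finset.sum_le_sum fun B _ => Set.indicator_le_self _ _ _) hp0.le
          _ = (A : Set X).indicator (fun _ => N ^ p) x := by simp [hxA]
          _ ≤ _ := Finset.single_le_sum
            (f := fun A : S => (A : Set X).indicator (fun _ => N ^ p) x) (fun _ _ => zero_le) hAT
      · push Not at hx
        have : u x = 0 := Finset.sum_eq_zero fun A hA => Set.indicator_of_notMem (hx A hA) _
        simp [this, hp0]
    refine ne_top_of_le_ne_top ?_ (lintegral_mono hle)
    rw [lintegral_finsetSum _ fun A _ => measurable_const.indicator (hmeas A)]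
    refine ENNReal.sum_ne_top.2 fun A _ => ?_
    rw [lintegral_indicator_const (hmeas A)]
    exact ENNReal.mul_ne_top hNtop (h.measure_lt_top A (hSℬ A.2)).ne
  set q := p / (p - 1) with hq
  have hpq : p.HolderConjugate q := Real.HolderConjugate.conjExponent hp
  have hpow : ∀ x, (u x ^ (p - 1)) ^ q = u x ^ p := fun x => by
    rw [← ENNReal.rpow_mul, hq, mul_div_cancel₀ _ hp1.ne']
  set M := carlesonConst q K with hM
  set g : Set X → ℝ≥0∞ := fun A => (∫⁻ x in A, u x ^ (p - 1) ∂μ) / μ A with hg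
  have hcarl : ∑ A ∈ T, μ (E A) * g A ^ q ≤ M * I := by
    have := h.tsum_measure_mul_rpow_le hS hE hd g (φ := fun x => u x ^ (p - 1)) (fun A hA a ha =>
      ⟨A, hSℬ hA, subset_rfl, ?_⟩) (hum.pow_const _).aemeasurable hpq.symm.lt (by simpa only [hpow])
    · simp only [hpow] at this
      exact (ENNReal.sum_le_tsum T).trans this
    · rwa [hg, ENNReal.lt_div_iff_mul_lt (Or.inl (h.measure_pos A (hSℬ hA)).ne')
        (Or.inl (h.measure_lt_top A (hSℬ hA)).ne)] at ha
  have hsplit : I = ∑ A ∈ T, c A * (g A * μ A) := by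
    have h1 : ∀ x, u x ^ p = ∑ A ∈ T, (A : Set X).indicator (fun x => c A * u x ^ (p - 1)) x := by
      intro x
      have : u x ^ p = u x * u x ^ (p - 1) := by
        conv_rhs => enter [1]; rw [← ENNReal.rpow_one (u x)]
        rw [← ENNReal.rpow_add_of_nonneg _ _ zero_le_one hp1.le]
        simp
      rw [this]
      conv_lhs => enter [1]; rw [hu]
      rw [Finset.sum_mul]
      refine Finset.sum_congr rfl fun A _ => ?_
      by_cases hx : x ∈ (A : Set X) <;> simp [hx]
    rw [hI, lintegral_congr h1, lintegral_finsetSum _ fun A _ =>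
      ((hum.pow_const _).const_mul _).indicator (hmeas A)]
    refine Finset.sum_congr rfl fun A _ => ?_
    rw [lintegral_indicator (hmeas A), lintegral_const_mul _ (hum.pow_const _), hg,
      ENNReal.div_mul_cancel (h.measure_pos A (hSℬ A.2)).ne' (h.measure_lt_top A (hSℬ A.2)).ne]
  -- Sparseness replaces `γ * μ A` by `μ (E A)`, which is split between the two Hölder factors.
  have hholder : γ * I ≤ D ^ (1 / p) * (M * I) ^ (1 / q) := by
    calc γ * I = ∑ A ∈ T, c A * g A * (γ * μ A) := by
          rw [hsplit, Finset.mul_sum]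
          exact Finset.sum_congr rfl fun A _ => by ring
      _ ≤ ∑ A ∈ T, (μ (E A) ^ (1 / p) * c A) * (μ (E A) ^ (1 / q) * g A) := by
          refine Finset.sum_le_sum fun A _ => ?_
          refine (mul_le_mul_right (hE A A.2).2.2 _).trans (le_of_eq ?_)
          have : μ (E A) = μ (E A) ^ (1 / p) * μ (E A) ^ (1 / q) := by
            rw [← ENNReal.rpow_add_of_nonneg _ _ (by positivity) (by simpa using hpq.symm.nonneg)]
            simp [hpq.inv_add_inv_eq_one]
          conv_lhs => rw [this]
          ring
      _ ≤ _ := by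
          refine (ENNReal.inner_le_Lp_mul_Lq T _ _ hpq).trans ?_
          have e : ∀ (r : ℝ) (a b : ℝ≥0∞), 0 < r → (a ^ (1 / r) * b) ^ r = a * b ^ r := by
            intro r a b hr
            rw [ENNReal.mul_rpow_of_nonneg _ _ hr.le, ← ENNReal.rpow_mul,
              one_div_mul_cancel hr.ne', ENNReal.rpow_one]
          simp only [e _ _ _ hp0, e _ _ _ hpq.symm.pos]
          gcongr
          exact ENNReal.sum_le_tsum T
  rcases eq_or_ne I 0 with hI0 | hI0
  · rw [hI0]; exact zero_le
  have hpqm : p / q = p - 1 := by rw [hq]; field_simp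
  have hfinal : (γ : ℝ≥0∞) ^ p * I * I ^ (p - 1) ≤ D * (M : ℝ≥0∞) ^ (p - 1) * I ^ (p - 1) := by
    have h2 := ENNReal.rpow_le_rpow hholder hp0.le
    rw [ENNReal.mul_rpow_of_nonneg _ _ hp0.le, ENNReal.mul_rpow_of_nonneg _ _ hp0.le,
      ← ENNReal.rpow_mul, ← ENNReal.rpow_mul, one_div_mul_cancel hp0.ne', ENNReal.rpow_one,
      one_div_mul_eq_div, hpqm, ENNReal.mul_rpow_of_nonneg _ _ hp1.le, ← mul_assoc] at h2
    refine le_trans (le_of_eq ?_) h2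
    rw [mul_assoc]
    congr 1
    conv_lhs => enter [1]; rw [← ENNReal.rpow_one I]
    rw [← ENNReal.rpow_add_of_nonneg _ _ zero_le_one hp1.le]
    simp
  have hcan := (ENNReal.mul_le_mul_iff_left (by simp [hI0, hItop] : I ^ (p - 1) ≠ 0)
    (by simp [hI0, hItop])).1 hfinal
  have hγp : γ ^ p ≠ 0 := by simp [hγ.ne']
  calc I = ((γ ^ p)⁻¹ : ℝ≥0) * ((γ : ℝ≥0∞) ^ p * I) := by
        rw [← mul_assoc, ENNReal.coe_inv hγp, ENNReal.coe_rpow_of_nonneg _ hp0.le,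
          ENNReal.inv_mul_cancel (by simp [hγ.ne']) (by simp [hp0.le]), one_mul]
    _ ≤ ((γ ^ p)⁻¹ : ℝ≥0) * (D * (M : ℝ≥0∞) ^ (p - 1)) := by gcongr
    _ = _ := by
        rw [sparseConst, ENNReal.coe_mul, ENNReal.coe_rpow_of_nonneg _ hp1.le]
        ring

/-- Sums over a sparse family are controlled in `L^p`, `p > 1`, by the sums over its disjoint
parts. -/
theorem lintegral_tsum_rpow_le (h : IsBallBasis μ ℬ K) (hSℬ : S ⊆ ℬ) (hγ : 0 < γ)
    (hE : ∀ A ∈ S, MeasurableSet (E A) ∧ E A ⊆ A ∧ γ * μ A ≤ μ (E A)) (hd : S.PairwiseDisjoint E)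
    (c : Set X → ℝ≥0∞) (hc : ∀ A ∈ S, c A ≠ ∞) {p : ℝ} (hp : 1 < p) :
    ∫⁻ x, (∑' A : S, (A : Set X).indicator (fun _ => c A) x) ^ p ∂μ ≤
      sparseConst p K γ * ∑' A : S, μ (E A) * c A ^ p := by
  have hp0 : 0 < p := by linarith
  have := (h.countable_of_pairwiseDisjoint hSℬ hγ hE hd).to_subtype
  have hsup : ∀ x, (∑' A : S, (A : Set X).indicator (fun _ => c A) x) ^ p =
      ⨆ T : Finset S, (∑ A ∈ T, (A : Set X).indicator (fun _ => c A) x) ^ p := fun x => by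
    rw [ENNReal.tsum_eq_iSup_sum]
    exact (ENNReal.orderIsoRpow p hp0).map_iSup _
  rw [lintegral_congr hsup, lintegral_iSup_directed]
  · exact iSup_le fun T => h.lintegral_finset_sum_rpow_le hSℬ hγ hE hd c hc hp T
  · exact fun T => ((Finset.measurable_sum _ fun (A : S) _ => measurable_const.indicator
      (h.measurableSet A (hSℬ A.2))).pow_const p).aemeasurable
  · refine Monotone.directed_le fun T T' hT x => ?_
    exact ENNReal.rpow_le_rpow (Finset.sum_le_sum_of_subset hT) hp0.le

end IsBallBasis

/-! ### Strong and weak bounds for the sparse operator. -/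

namespace IsBallBasis

variable {X : Type*} [MeasurableSpace X] {μ : Measure X} {ℬ S : Set (Set X)} {K γ : ℝ≥0}
  {E : Set X → Set X} {φ : X → ℝ≥0∞}

/-- The disjoint sums of bounded coefficients are controlled by the weak type inequality. -/
theorem tsum_measure_mul_sq_le (h : IsBallBasis μ ℬ K) (hS : S.Countable)
    (hE : ∀ A ∈ S, MeasurableSet (E A) ∧ E A ⊆ A ∧ γ * μ A ≤ μ (E A)) (hd : S.PairwiseDisjoint E)
    (c : Set X → ℝ≥0∞)
    (hc : ∀ A ∈ S, ∀ a < c A, ∃ B ∈ ℬ, A ⊆ B ∧ a * μ B < ∫⁻ x in B, φ x ∂μ)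
    {b : ℝ} (hcb : ∀ A ∈ S, c A ≤ ENNReal.ofReal b) :
    ∑' A : S, μ (E A) * c A ^ (2 : ℝ) ≤ 2 * (ENNReal.ofReal b * (K * ∫⁻ x, φ x ∂μ)) := by
  have key := @lintegral_rpow_eq_lintegral_measure_ofReal_lt S ⊤
    (pointMasses fun A : S => μ (E A)) (fun A : S => c A)
    (@Measurable.aemeasurable _ _ ⊤ _ _ _ (fun _ _ => trivial))
    (Filter.Eventually.of_forall fun A => ne_top_of_le_ne_top ENNReal.ofReal_ne_top (hcb A A.2))
    2 two_pos
  rw [lintegral_pointMasses] at key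
  rw [key, ENNReal.ofReal_ofNat]
  refine mul_le_mul_right ?_ _
  -- For exponent `2` the layer-cake integrand is the weak type quantity itself; it vanishes for `t
  -- ≥ b`.
  calc _ ≤ ∫⁻ t in Set.Ioi (0 : ℝ), (Set.Iio b).indicator (fun _ => K * ∫⁻ x, φ x ∂μ) t := by
        refine setLIntegral_mono' measurableSet_Ioi fun t ht => ?_
        rw [pointMasses_apply]
        by_cases htb : t < b
        · rw [Set.indicator_of_mem (show t ∈ Set.Iio b from htb), mul_comm,
            show t ^ ((2 : ℝ) - 1) = t by norm_num]
          exact (mul_le_mul_right (tsum_indicator_measure_le hS hE hd c hc _) _).trans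
            (h.mul_measure_sUnion_le _ _)
        · have : ∀ A : S, {A : S | ENNReal.ofReal t < c A}.indicator (fun A : S => μ (E A)) A = 0 :=
            fun A => Set.indicator_of_notMem (s := {A : S | ENNReal.ofReal t < c A}) (not_lt.2 ((hcb A A.2).trans
              (ENNReal.ofReal_le_ofReal (not_lt.1 htb)))) _
          simp [this]
    _ = _ := by
        rw [lintegral_indicator_const measurableSet_Iio, Measure.restrict_apply measurableSet_Iio,
          Set.Iio_inter_Ioi, Real.volume_Ioo, sub_zero, mul_comm]

variable {𝕜 : Type*} [RCLike 𝕜] {f : X → 𝕜} {r : ℝ}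

theorem exists_mul_measure_lt_of_lt_ballAverageSup_rpow (h : IsBallBasis μ ℬ K) (hr : 0 < r)
    {A : Set X} {a : ℝ≥0∞} (ha : a < ballAverageSup μ ℬ r f A ^ r) :
    ∃ B ∈ ℬ, A ⊆ B ∧ a * μ B < ∫⁻ x in B, ‖f x‖ₑ ^ r ∂μ := by
  have h1 : a ^ (1 / r) < ballAverageSup μ ℬ r f A := by
    rwa [one_div, ENNReal.rpow_inv_lt_iff hr]
  simp only [ballAverageSup, lt_iSup_iff] at h1
  obtain ⟨B, ⟨hB, hAB⟩, hlt⟩ := h1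
  refine ⟨B, hB, hAB, ?_⟩
  rwa [ballAverage, ENNReal.rpow_lt_rpow_iff (by positivity),
    ENNReal.lt_div_iff_mul_lt (Or.inl (h.measure_pos B hB).ne')
      (Or.inl (h.measure_lt_top B hB).ne)] at hlt

theorem lintegral_strongSparse_rpow_le (h : IsBallBasis μ ℬ K) (hSℬ : S ⊆ ℬ) (hγ : 0 < γ)
    (hS : IsSparse μ γ S) (hr : 1 ≤ r) {p : ℝ} (hrp : r < p) (hf : AEStronglyMeasurable f μ)
    (hfin : ∫⁻ x, ‖f x‖ₑ ^ p ∂μ ≠ ∞) :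
    ∫⁻ x, strongSparse μ ℬ S r f x ^ p ∂μ ≤
      (sparseConst p K γ * carlesonConst (p / r) K : ℝ≥0) * ∫⁻ x, ‖f x‖ₑ ^ p ∂μ := by
  have hr0 : 0 < r := by linarith
  have hp0 : 0 < p := by linarith
  obtain ⟨E, hE, hd⟩ := hS
  have hpow : ∀ a : ℝ≥0∞, (a ^ r) ^ (p / r) = a ^ p := fun a => by
    rw [← ENNReal.rpow_mul, mul_div_cancel₀ _ hr0.ne']
  have hcarl := h.tsum_measure_mul_rpow_le (h.countable_of_pairwiseDisjoint hSℬ hγ hE hd) hE hd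
    (fun A => ballAverageSup μ ℬ r f A ^ r) (φ := fun x => ‖f x‖ₑ ^ r)
    (fun A _ a ha => h.exists_mul_measure_lt_of_lt_ballAverageSup_rpow hr0 ha)
    (hf.enorm.pow_const r) ((one_lt_div hr0).2 hrp) (by simpa only [hpow])
  simp only [hpow] at hcarl
  -- As `μ (E A) > 0`, one infinite coefficient would make the finite Carleson sum infinite.
  have hc : ∀ A ∈ S, ballAverageSup μ ℬ r f A ≠ ∞ := fun A hA hA' => by
    have h1 := (ENNReal.le_tsum (⟨A, hA⟩ : S)).trans hcarl
    have h2 : μ (E A) ≠ 0 := (lt_of_lt_of_le (ENNReal.mul_pos (by simpa using hγ.ne')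
      (h.measure_pos A (hSℬ hA)).ne') (hE A hA).2.2).ne'
    rw [hA', ENNReal.top_rpow_of_pos hp0, ENNReal.mul_top h2] at h1
    exact ENNReal.mul_ne_top ENNReal.coe_ne_top hfin (top_le_iff.1 h1)
  refine (h.lintegral_tsum_rpow_le hSℬ hγ hE hd (ballAverageSup μ ℬ r f) hc
    (hr.trans_lt hrp)).trans ?_
  rw [ENNReal.coe_mul, mul_assoc]
  gcongr

theorem measurable_strongSparse (h : IsBallBasis μ ℬ K) (hSℬ : S ⊆ ℬ) (hS : S.Countable) :
    Measurable (strongSparse μ ℬ S r f) := by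
  have := hS.to_subtype
  exact Measurable.tsum fun A => measurable_const.indicator (h.measurableSet A (hSℬ A.2))

theorem eLpNorm_strongSparse_le (h : IsBallBasis μ ℬ K) (hSℬ : S ⊆ ℬ) (hγ : 0 < γ)
    (hS : IsSparse μ γ S) (hr : 1 ≤ r) {p : ℝ} (hrp : r < p) (hf : MemLp f (ENNReal.ofReal p) μ) :
    eLpNorm (strongSparse μ ℬ S r f) (ENNReal.ofReal p) μ ≤
      ((sparseConst p K γ * carlesonConst (p / r) K) ^ (1 / p) : ℝ≥0) *
        eLpNorm f (ENNReal.ofReal p) μ := by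
  have hp0 : 0 < p := by linarith
  have hp : ENNReal.ofReal p ≠ 0 := by simpa using hp0
  have hfin := lintegral_rpow_enorm_lt_top_of_eLpNorm_lt_top hp ENNReal.ofReal_ne_top hf.2
  rw [ENNReal.toReal_ofReal hp0.le] at hfin
  rw [eLpNorm_eq_lintegral_rpow_enorm_toReal hp ENNReal.ofReal_ne_top,
    eLpNorm_eq_lintegral_rpow_enorm_toReal hp ENNReal.ofReal_ne_top, ENNReal.toReal_ofReal hp0.le,
    ENNReal.coe_rpow_of_nonneg _ (by positivity : 0 ≤ 1 / p),
    ← ENNReal.mul_rpow_of_nonneg _ _ (by positivity : 0 ≤ 1 / p)]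
  exact ENNReal.rpow_le_rpow
    (h.lintegral_strongSparse_rpow_le hSℬ hγ hS hr hrp hf.1 hfin.ne) (by positivity)

theorem measure_lt_strongSparse_le (h : IsBallBasis μ ℬ K) (hSℬ : S ⊆ ℬ) (hγ : 0 < γ)
    (hS : IsSparse μ γ S) (hr : 1 ≤ r) {t : ℝ} (ht : 0 < t) :
    μ {x | ENNReal.ofReal t < strongSparse μ ℬ S r f x} ≤
      (K + 2 * sparseConst (2 * r) K γ * K : ℝ≥0) * (∫⁻ x, ‖f x‖ₑ ^ r ∂μ) /
        ENNReal.ofReal t ^ r := by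
  have hr0 : 0 < r := by linarith
  obtain ⟨E, hE, hd⟩ := hS
  set τ := ENNReal.ofReal t with hτ
  set c := ballAverageSup μ ℬ r f with hcdef
  set N := ∫⁻ x, ‖f x‖ₑ ^ r ∂μ with hN
  have hτ0 : τ ^ r ≠ 0 := by simp [hτ, ht]
  have hτtop : τ ^ r ≠ ∞ := ENNReal.rpow_ne_top_of_nonneg hr0.le ENNReal.ofReal_ne_top
  set S' := {A ∈ S | c A ≤ τ} with hS'
  have hS'S : S' ⊆ S := fun A hA => hA.1
  have hE' : ∀ A ∈ S', MeasurableSet (E A) ∧ E A ⊆ A ∧ γ * μ A ≤ μ (E A) := fun A hA => hE A hA.1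
  have hd' : S'.PairwiseDisjoint E := hd.subset hS'S
  have hcount := h.countable_of_pairwiseDisjoint (hS'S.trans hSℬ) hγ hE' hd'
  set bad := ⋃₀ {B ∈ ℬ | τ ^ r * μ B < ∫⁻ x in B, ‖f x‖ₑ ^ r ∂μ} with hbad
  have hin : ∀ A ∈ S, ¬ c A ≤ τ → A ⊆ bad := fun A _ hA => by
    obtain ⟨B, hB, hAB, hlt⟩ := h.exists_mul_measure_lt_of_lt_ballAverageSup_rpow hr0
      (ENNReal.rpow_lt_rpow (not_le.1 hA) hr0)
    exact fun x hx => ⟨B, ⟨hB, hlt⟩, hAB hx⟩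
  set v : X → ℝ≥0∞ := fun x => (∑' A : S', (A : Set X).indicator (fun _ => c A) x) ^ (2 * r) with hv
  -- Off `bad`, only balls of `S'` contribute to the sum.
  have hsub : {x | τ < strongSparse μ ℬ S r f x} ⊆ bad ∪ {x | τ ^ (2 * r) ≤ v x} := by
    intro x hx
    by_cases hxb : x ∈ bad
    · exact Or.inl hxb
    refine Or.inr (ENNReal.rpow_le_rpow (le_of_lt (lt_of_lt_of_eq hx ?_)) (by positivity))
    rw [strongSparse, tsum_subtype S fun A : Set X => A.indicator (fun _ => c A) x,
      tsum_subtype S' fun A : Set X => A.indicator (fun _ => c A) x]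
    refine tsum_congr fun A => ?_
    by_cases hAS : A ∈ S
    · by_cases hA : c A ≤ τ
      · rw [Set.indicator_of_mem hAS, Set.indicator_of_mem (show A ∈ S' from ⟨hAS, hA⟩)]
      · rw [Set.indicator_of_mem hAS, Set.indicator_of_notMem (fun hA' : A ∈ S' => hA hA'.2),
          Set.indicator_of_notMem fun hxA => hxb (hin A hAS hA hxA)]
    · rw [Set.indicator_of_notMem hAS, Set.indicator_of_notMem fun hA' : A ∈ S' => hAS hA'.1]
  have hbadle : τ ^ r * μ bad ≤ K * N := h.mul_measure_sUnion_le _ _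
  have hgood : τ ^ r * μ {x | τ ^ (2 * r) ≤ v x} ≤ 2 * sparseConst (2 * r) K γ * K * N := by
    have hvm : Measurable v := by
      have := hcount.to_subtype
      exact (Measurable.tsum fun A : S' => measurable_const.indicator
        (h.measurableSet A (hSℬ A.2.1))).pow_const _
    have hτr : τ ^ r = ENNReal.ofReal (t ^ r) := ENNReal.ofReal_rpow_of_pos ht
    have h2 : ∀ a : ℝ≥0∞, (a ^ r) ^ (2 : ℝ) = a ^ (2 * r) := fun a => by
      rw [← ENNReal.rpow_mul, mul_comm]
    have hsq := h.tsum_measure_mul_sq_le hcount hE' hd' (fun A => c A ^ r)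
      (φ := fun x => ‖f x‖ₑ ^ r) (b := t ^ r)
      (fun A _ a ha => h.exists_mul_measure_lt_of_lt_ballAverageSup_rpow hr0 ha)
      (fun A hA => hτr ▸ ENNReal.rpow_le_rpow hA.2 hr0.le)
    simp only [h2] at hsq
    rw [← hτr] at hsq
    have hsum := h.lintegral_tsum_rpow_le (hS'S.trans hSℬ) hγ hE' hd' c
      (fun A hA => ne_top_of_le_ne_top ENNReal.ofReal_ne_top hA.2) (by linarith : 1 < 2 * r)
    have hmarkov := mul_meas_ge_le_lintegral (μ := μ) hvm (τ ^ (2 * r))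
    -- Chebyshev gains `τ ^ (2 * r)`; the bound on the coefficients costs only `τ ^ r`.
    refine (ENNReal.mul_le_mul_iff_right hτ0 hτtop).1 ?_
    calc τ ^ r * (τ ^ r * μ {x | τ ^ (2 * r) ≤ v x})
        = τ ^ (2 * r) * μ {x | τ ^ (2 * r) ≤ v x} := by
          rw [← mul_assoc, ← ENNReal.rpow_add_of_nonneg _ _ hr0.le hr0.le, two_mul]
      _ ≤ sparseConst (2 * r) K γ * (2 * (τ ^ r * (K * N))) :=
          hmarkov.trans (hsum.trans (mul_le_mul_right hsq _))
      _ = τ ^ r * (2 * sparseConst (2 * r) K γ * K * N) := by ring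
  rw [ENNReal.le_div_iff_mul_le (Or.inl hτ0) (Or.inl hτtop), mul_comm]
  calc τ ^ r * μ {x | τ < strongSparse μ ℬ S r f x}
      ≤ τ ^ r * (μ bad + μ {x | τ ^ (2 * r) ≤ v x}) := by
        gcongr
        exact (measure_mono hsub).trans (measure_union_le _ _)
    _ ≤ K * N + 2 * sparseConst (2 * r) K γ * K * N := by
        rw [mul_add]
        exact add_le_add hbadle hgood
    _ = _ := by
        push_cast
        ring

end IsBallBasis

theorem theorem1 (r : ℝ) (hr : 1 ≤ r) (K γ : ℝ≥0) (hγ0 : 0 < γ) (hγ1 : γ < 1) :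
    (∀ p : ℝ, r < p → ∃ C : ℝ≥0, ∀ (X : Type*) [MeasurableSpace X] (μ : Measure X)
        (ℬ S : Set (Set X)), IsBallBasis μ ℬ K → S ⊆ ℬ → IsSparse μ γ S →
        ∀ (𝕜 : Type*) [RCLike 𝕜] (f : X → 𝕜), MemLp f (ENNReal.ofReal p) μ →
          MemLp (strongSparse μ ℬ S r f) (ENNReal.ofReal p) μ ∧
          eLpNorm (strongSparse μ ℬ S r f) (ENNReal.ofReal p) μ
            ≤ C * eLpNorm f (ENNReal.ofReal p) μ) ∧
    (∃ C : ℝ≥0, ∀ (X : Type*) [MeasurableSpace X] (μ : Measure X)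
        (ℬ S : Set (Set X)), IsBallBasis μ ℬ K → S ⊆ ℬ → IsSparse μ γ S →
        ∀ (𝕜 : Type*) [RCLike 𝕜] (f : X → 𝕜), MemLp f (ENNReal.ofReal r) μ →
          ∀ t : ℝ, 0 < t →
            μ {x | ENNReal.ofReal t < strongSparse μ ℬ S r f x}
              ≤ C * eLpNorm f (ENNReal.ofReal r) μ ^ r / ENNReal.ofReal t ^ r) := by
  have hr0 : 0 < r := by linarith
  refine ⟨fun p hrp => ⟨(sparseConst p K γ * carlesonConst (p / r) K) ^ (1 / p), ?_⟩,
    K + 2 * sparseConst (2 * r) K γ * K, ?_⟩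
  · intro X _ μ ℬ S h hSℬ hS 𝕜 _ f hf
    have hle := h.eLpNorm_strongSparse_le hSℬ hγ0 hS hr hrp hf
    have hcount : S.Countable := by
      obtain ⟨E, hE, hd⟩ := hS
      exact h.countable_of_pairwiseDisjoint hSℬ hγ0 hE hd
    exact ⟨⟨(h.measurable_strongSparse hSℬ hcount).aestronglyMeasurable,
      hle.trans_lt (ENNReal.mul_lt_top ENNReal.coe_lt_top hf.2)⟩, hle⟩
  · intro X _ μ ℬ S h hSℬ hS 𝕜 _ f _ t ht
    have hN : eLpNorm f (ENNReal.ofReal r) μ ^ r = ∫⁻ x, ‖f x‖ₑ ^ r ∂μ := by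
      rw [eLpNorm_eq_lintegral_rpow_enorm_toReal (by simpa using hr0) ENNReal.ofReal_ne_top,
        ENNReal.toReal_ofReal hr0.le, ← ENNReal.rpow_mul, one_div_mul_cancel hr0.ne',
        ENNReal.rpow_one]
    rw [hN]
    exact h.measure_lt_strongSparse_le hSℬ hγ0 hS hr ht
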